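/- Let $g\ge 1$. For $\ell=(\ell_1,\dots,\ell_g)$ with all $\ell_i>0$ put $a=\ell_1+\dots+\ell_g$ and $\ell_{2g+1-i}=\ell_i$. Let $P_0=(0,-a),P_1,\dots,P_{2g}=(a,0)$ be the vertices of the staircase arc whose $k$-th edge $P_{k-1}P_k$ has length $\ell_k$ and points in the positive $x$-direction for odd $k$ and in the positive $y$-direction for even $k$. The arc is symmetric in the line $y=-x$, and $P_g=(c,-c)$ with $c=c(\ell)>0$. Let the zigzag $Z$ consist of this arc, the ray $\{x=0,\ y\le -a\}$ and the ray $\{y=0,\ x\ge a\}$. For $b>c$ let - $\Omega_+$ be the intersection of the region on the upper left of $Z$ with $\{x>-b\}\cap\{y<b\}$, - $\Omega_-$ be the region on the lower right of $Z$ with the quadrant $\{x\ge b,\ y\le -b\}$ removed. These are the two orthodisks $\Omega_{Gdh}$ and $\Omega_{G^{-1}dh}$ for $S_g$ ($\Omega_{Gdh}$ being the one whose angle at $P_g$ is $3\pi/2$). Each has one half-infinite vertical strip, with end $E_2$, and one half-infinite horizontal strip, with end $E_1$, both of width $b$. The remaining vertex is $V=(-b,b)$ for $\Omega_+$ and $V=(b,-b)$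 for $\Omega_-$. The $2g+4$ edges, in cyclic order, are $E_2P_0,\ P_0P_1,\dots,P_{2g-1}P_{2g},\ P_{2g}E_1,\ E_1V,\ VE_2$. A cycle is a pair of distinct non-adjacent edges $e,f$. Its extremal length in $\Omega=\Omega_\pm$ is $$\operatorname{Ext}_\Omega(e,f)=\sup_\rho\frac{\bigl(\inf_\gamma\int_\gamma\rho\,|dz|\bigr)^2}{\iint_\Omega\rho^2\,dx\,dy},$$ where $\gamma$ ranges over the rectifiable arcs in $\Omega$ from $e$ to $f$ and $\rho$ over the Borel conformal metrics with area $0<\iint_\Omega\rho^2\,dx\,dy<\infty$. Pairs of orthodisks are considered up to homothety, normalized so that the finite edges of the zigzag have total length $1$. The space of geometric coordinates is $$\Delta_g=\{(\ell,b)\in\mathbb R^g\times\mathbb R:\ \ell_i>0 \text{ for all } i,\ b>c(\ell),\ 2(\ell_1+\dots+\ell_g)=1\}.$$ **Theorem.** The coordinate system $(\ell,b)$ for $S_g$ is complete: whenever a coordinate degenerates, at least one of the two orthodisks degenerates conformally. Precisely: 1. If a sequence in $\Delta_g$ eventually leaves every compact subset of $\Delta_g$ (that is, $\min(\ell_1,\dots,\ell_g,\,b-c,\,1/b)\to0$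 along it), then there are a subsequence, one of the two orthodisks, and a cycle, such that along the subsequence the extremal length of this cycle in this orthodisk tends to $0$ or tends to $\infty$. 2. Let $q$ be a boundary point of $\Delta_g$, that is, a point of $\overline{\Delta_g}\setminus\Delta_g$, the closure being taken in $\mathbb R^g\times[-\infty,\infty]$ (so that $b=\infty$ is allowed). Then there are one of the two orthodisks and a cycle, depending only on $q$, whose extremal length in that orthodisk tends to $0$ or tends to $\infty$ as $(\ell,b)\in\Delta_g$ tends to $q$. -/

import Mathlib

open Filter Topology MeasureTheory
open scoped ENNReal

noncomputable section

namespace ScherkOrthodisk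

/-- The length of the arc `γ : [0,1] → ℂ` in the conformal metric `ρ |dz|`. -/
def rhoLength (ρ : ℂ → ℝ≥0∞) (γ : ℝ → ℂ) : ℝ≥0∞ :=
  ∫⁻ t in Set.Icc (0 : ℝ) 1, ρ (γ t) * ‖deriv γ t‖ₑ

/-- The area of `Ω` in the conformal metric `ρ |dz|`. -/
def rhoArea (Ω : Set ℂ) (ρ : ℂ → ℝ≥0∞) : ℝ≥0∞ :=
  ∫⁻ z in Ω, ρ z ^ 2

/-- The rectifiable arcs running inside `Ω` from the boundary set `A` to the boundary set `B`.
A rectifiable arc is given by a Lipschitz parametrization on `[0,1]`. -/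
def arcFamily (Ω A B : Set ℂ) : Set (ℝ → ℂ) :=
  {γ | (∃ K, LipschitzOnWith K γ (Set.Icc 0 1)) ∧ γ 0 ∈ A ∧ γ 1 ∈ B ∧
    ∀ t ∈ Set.Ioo (0 : ℝ) 1, γ t ∈ Ω}

/-- The extremal length in `Ω` of the family of arcs joining `A` to `B`: the supremum of
`ℓ_ρ(Γ)² / Area(ρ)` over all Borel conformal metrics `ρ |dz|` with `0 < Area(ρ) < ∞`, where
`ℓ_ρ(Γ)` is the infimum of the `ρ`-lengths of the arcs in the family. -/
def extremalLength (Ω A B : Set ℂ) : ℝ≥0∞ :=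
  ⨆ (ρ : ℂ → ℝ≥0∞) (_ : Measurable ρ) (_ : 0 < rhoArea Ω ρ) (_ : rhoArea Ω ρ < ∞),
    (⨅ γ ∈ arcFamily Ω A B, rhoLength ρ γ) ^ 2 / rhoArea Ω ρ

/-- The lengths of the `2g` finite edges of the zigzag, in their order along the zigzag. The first
`g` of them are prescribed, the other ones follow from the symmetry in the diagonal `y = -x`. -/
def edgeLen {g : ℕ} (l : Fin g → ℝ) (j : ℕ) : ℝ :=
  if h : j < g then l ⟨j, h⟩
  else if h' : j < 2 * g then l ⟨2 * g - 1 - j, by omega⟩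
  else 0

/-- The number `a` for which the zigzag replaces the part of the boundary of the fourth quadrant
that runs from `(0,-a)` to `(a,0)`. -/
def cornerSize {g : ℕ} (l : Fin g → ℝ) : ℝ := ∑ i, l i

/-- The vertices `P_0, …, P_{2g}` of the zigzag: it starts at `P_0 = (0,-a)`, and its edges
alternately go to the right and up. -/
def vertex {g : ℕ} (l : Fin g → ℝ) (k : ℕ) : ℂ :=
  ⟨0, -cornerSize l⟩ +
    ∑ j ∈ Finset.range k, (edgeLen l j : ℂ) * (if Even j then 1 else Complex.I)

/-- The abscissa `c` of the vertex `P_g = (c,-c)` on the diagonal `y = -x`. -/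
def diagCoord {g : ℕ} (l : Fin g → ℝ) : ℝ := (vertex l g).re

/-- The whole zigzag, from `(0,-∞)` to `(∞,0)`. -/
def zigzag {g : ℕ} (l : Fin g → ℝ) : Set ℂ :=
  {z | z.re = 0 ∧ z.im ≤ -cornerSize l} ∪
    (⋃ k ∈ Finset.range (2 * g), segment ℝ (vertex l k) (vertex l (k + 1))) ∪
    {z | z.im = 0 ∧ cornerSize l ≤ z.re}

/-- The two regions separated by the zigzag, and likewise the two orthodisks. -/
inductive Side
  | upperLeft
  | lowerRight

/-- The orthodisks with finite edge lengths `x.1` and strip width `x.2 = b`. The upper left one is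
cut off by the half planes `x > -b` and `y < b`; from the lower right one the quadrant
`x ≥ b, y ≤ -b` is removed. Both have a half-infinite vertical strip and a half-infinite
horizontal strip of width `b`. -/
def orthodisk {g : ℕ} (s : Side) (x : (Fin g → ℝ) × ℝ) : Set ℂ :=
  match s with
  | .upperLeft =>
    {z | z ∉ zigzag x.1 ∧ (∃ w ∈ zigzag x.1, z.re ≤ w.re ∧ w.im ≤ z.im) ∧
      -x.2 < z.re ∧ z.im < x.2}
  | .lowerRight =>
    {z | z ∉ zigzag x.1 ∧ (∃ w ∈ zigzag x.1, w.re ≤ z.re ∧ z.im ≤ w.im) ∧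
      (z.re < x.2 ∨ -x.2 < z.im)}

/-- The `2g + 4` edges of an orthodisk in their cyclic order: `E_2 P_0`, then `P_{k-1} P_k` for
`k = 1, …, 2g`, then `P_{2g} E_1`, `E_1 V` and `V E_2`. Here `E_2` and `E_1` are the ends of the
vertical and of the horizontal strip, and `V` is the finite vertex `(-b,b)` or `(b,-b)`. -/
def edge {g : ℕ} (s : Side) (x : (Fin g → ℝ) × ℝ) (k : ℕ) : Set ℂ :=
  if k = 0 then {z | z.re = 0 ∧ z.im < -cornerSize x.1}
  else if k ≤ 2 * g then openSegment ℝ (vertex x.1 (k - 1)) (vertex x.1 k)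
  else if k = 2 * g + 1 then {z | z.im = 0 ∧ cornerSize x.1 < z.re}
  else if k = 2 * g + 2 then
    match s with
    | .upperLeft => {z | z.im = x.2 ∧ -x.2 < z.re}
    | .lowerRight => {z | z.im = -x.2 ∧ x.2 < z.re}
  else
    match s with
    | .upperLeft => {z | z.re = -x.2 ∧ z.im < x.2}
    | .lowerRight => {z | z.re = x.2 ∧ z.im < -x.2}

/-- `i < j` are the positions of two edges, among the `2g + 4` edges in cyclic order, that are
different and not adjacent. -/
def IsCycle (g i j : ℕ) : Prop :=
  i + 2 ≤ j ∧ j < 2 * g + 4 ∧ j < i + (2 * g + 3)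

/-- The extremal length of the cycle that joins the edges number `i` and `j` of an orthodisk. -/
def extCycle {g : ℕ} (s : Side) (i j : ℕ) (x : (Fin g → ℝ) × ℝ) : ℝ≥0∞ :=
  extremalLength (orthodisk s x) (edge s x i) (edge s x j)

/-- The space `Δ_g` of geometric coordinates: edge lengths `l_i > 0` and a strip width `b > c`.
The pairs of orthodisks are considered up to homothety: the total length of the finite edges of the
zigzag is normalized to be `1`. -/
def coordDomain (g : ℕ) : Set ((Fin g → ℝ) × ℝ) :=
  {x | (∀ i, 0 < x.1 i) ∧ diagCoord x.1 < x.2 ∧ 2 * ∑ i, x.1 i = 1}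

/-- The coordinates in the space in which `Δ_g` has compact closure: the strip width is allowed to
become infinite. -/
def toExtended (g : ℕ) (x : coordDomain g) : (Fin g → ℝ) × EReal :=
  (x.1.1, (x.1.2 : EReal))

/-- The boundary of `Δ_g`: a limit point of `Δ_g` in which some coordinate has degenerated. -/
def coordBoundary (g : ℕ) : Set ((Fin g → ℝ) × EReal) :=
  closure (Set.range (toExtended g)) \ Set.range (toExtended g)

end ScherkOrthodisk

end

namespace ScherkOrthodisk

/-! At every boundary point of `Δ_g` some cycle has extremal length tending to `0`; the alternative
`∞` never has to be used. The tool is the length-area method (`extremalLength_le_of_hasArc`): if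
every circle about a point `O` with radius in `(ε, R)` contains an arc of the family, the extremal
length is at most `2π / log (R / ε)`. So it suffices to find annuli of unbounded modulus whose
circles are crossed by the right edges.

Let `q` be a boundary point with widths tending to `b`; the sign and diagonal conditions survive as
weak inequalities, `0 ≤ ℓ_i` and `c ≤ b`. There are four cases. If `b = ∞`, quarter circles about
`0` join the two infinite zigzag edges in the lower right orthodisk (`hasArc_infinite_edges`). If
all `ℓ_i > 0`, then `b = c`, and circles about `P_g` join the edge before `P_g` to `V E_2` in the
lower right orthodisk (`hasArc_lowerRight`). If some `ℓ_i = 0` and `b = 0`, then `P_0, …, P_g` all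
tend to the line `x = 0 = b`, and the same lemma applies to any edge of the first half that keeps
positive length. If some `ℓ_i = 0` and `0 < b < ∞`, the two edges that bound a collapsed run are
joined in the upper left orthodisk by circles about the limit vertex side of the run
(`hasArc_upperLeft`).

Membership of an arc in an orthodisk rests on `zigzag_chain`: the zigzag is a chain for the
coordinatewise order, so a point strictly to the upper left or lower right of a single zigzag point
is off the zigzag and on the right side of it. The statement on sequences follows by compactness of
the closure, with the width in `EReal`. -/

/-! ### Circles and circular arcs -/

/-- The point of the circle about `O` of radius `r` in the direction `θ`. -/
noncomputable def circlePt (O : ℂ) (r θ : ℝ) : ℂ :=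
  O + (r : ℂ) * (↑(Real.cos θ) + ↑(Real.sin θ) * Complex.I)

@[simp] lemma circlePt_re (O : ℂ) (r θ : ℝ) : (circlePt O r θ).re = O.re + r * Real.cos θ := by
  simp [circlePt, -Complex.ofReal_cos, -Complex.ofReal_sin]

@[simp] lemma circlePt_im (O : ℂ) (r θ : ℝ) : (circlePt O r θ).im = O.im + r * Real.sin θ := by
  simp [circlePt, -Complex.ofReal_cos, -Complex.ofReal_sin]

lemma continuous_circlePt (O : ℂ) (r : ℝ) : Continuous (circlePt O r) := by
  unfold circlePt; fun_prop

lemma circlePt_periodic (O : ℂ) (r : ℝ) : Function.Periodic (circlePt O r) (2 * Real.pi) := by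
  intro θ; simp [circlePt]

lemma hasDerivAt_circlePt (O : ℂ) (r θ : ℝ) :
    HasDerivAt (circlePt O r)
      ((r : ℂ) * (-↑(Real.sin θ) + ↑(Real.cos θ) * Complex.I)) θ := by
  have hc := (Real.hasDerivAt_cos θ).ofReal_comp
  have hs := (Real.hasDerivAt_sin θ).ofReal_comp
  have h := ((hc.add (hs.mul_const Complex.I)).const_mul (r : ℂ)).const_add O
  have e : (r : ℂ) * (-↑(Real.sin θ) + ↑(Real.cos θ) * Complex.I) =
      (r : ℂ) * (↑(-Real.sin θ) + ↑(Real.cos θ) * Complex.I) := by push_cast; ring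
  rw [e]
  exact h

lemma norm_circlePt_deriv {r : ℝ} (hr : 0 ≤ r) (θ : ℝ) :
    ‖(r : ℂ) * (-↑(Real.sin θ) + ↑(Real.cos θ) * Complex.I)‖ = r := by
  have h : ‖(-↑(Real.sin θ) + ↑(Real.cos θ) * Complex.I : ℂ)‖ = 1 := by
    have := Complex.norm_add_mul_I (-Real.sin θ) (Real.cos θ)
    push_cast at this
    push_cast
    rw [this]
    simp
  rw [norm_mul, h]
  simp [abs_of_nonneg hr]

/-- The circular arc about `O` of radius `r` from the direction `α` to the direction `β`. -/
noncomputable def circArc (O : ℂ) (r α β : ℝ) (t : ℝ) : ℂ := circlePt O r (α + t * (β - α))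

lemma hasDerivAt_circArc (O : ℂ) (r α β t : ℝ) :
    HasDerivAt (circArc O r α β)
      (((β - α : ℝ) : ℂ) * ((r : ℂ) * (-↑(Real.sin (α + t * (β - α))) +
        ↑(Real.cos (α + t * (β - α))) * Complex.I))) t := by
  have h1 : HasDerivAt (fun t : ℝ => α + t * (β - α)) (β - α) t := by
    simpa using ((hasDerivAt_id t).mul_const (β - α)).const_add α
  have h2 := (hasDerivAt_circlePt O r (α + t * (β - α))).scomp t h1
  exact h2

lemma norm_deriv_circArc (O : ℂ) {r : ℝ} (hr : 0 ≤ r) (α β t : ℝ) :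
    ‖deriv (circArc O r α β) t‖ = |β - α| * r := by
  rw [(hasDerivAt_circArc O r α β t).deriv, norm_mul, norm_circlePt_deriv hr, Complex.norm_real,
    Real.norm_eq_abs]

lemma lipschitz_circArc (O : ℂ) {r : ℝ} (hr : 0 ≤ r) (α β : ℝ) :
    ∃ K, LipschitzOnWith K (circArc O r α β) (Set.Icc 0 1) := by
  refine ⟨Real.toNNReal (|β - α| * r), LipschitzWith.lipschitzOnWith ?_⟩
  refine lipschitzWith_of_nnnorm_deriv_le
    (fun t => (hasDerivAt_circArc O r α β t).differentiableAt) fun t => ?_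
  rw [← NNReal.coe_le_coe]
  rw [Real.coe_toNNReal _ (by positivity), coe_nnnorm]
  exact (norm_deriv_circArc O hr α β t).le

/-! ### The length-area estimate -/

/-- The circle about `O` of radius `r` contains an arc inside `Ω` from `A` to `B`. -/
def HasArc (Ω A B : Set ℂ) (O : ℂ) (r : ℝ) : Prop :=
  ∃ α β : ℝ, α ≠ β ∧ |β - α| ≤ 2 * Real.pi ∧ circlePt O r α ∈ A ∧ circlePt O r β ∈ B ∧
    ∀ θ ∈ Set.Ioo (min α β) (max α β), circlePt O r θ ∈ Ω

lemma image_lineMap_Ioo_subset (α β : ℝ) :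
    (fun t : ℝ => α + t * (β - α)) '' Set.Ioo 0 1 ⊆ Set.Icc (min α β) (max α β) := by
  rintro _ ⟨t, ⟨h0, h1⟩, rfl⟩
  rcases le_total α β with h | h
  · rw [min_eq_left h, max_eq_right h]
    constructor <;> nlinarith
  · rw [min_eq_right h, max_eq_left h]
    constructor <;> nlinarith

lemma lineMap_mem_Ioo {α β t : ℝ} (hne : α ≠ β) (ht : t ∈ Set.Ioo (0 : ℝ) 1) :
    α + t * (β - α) ∈ Set.Ioo (min α β) (max α β) := by
  obtain ⟨h0, h1⟩ := ht
  rcases lt_or_gt_of_ne hne with h | h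
  · rw [min_eq_left h.le, max_eq_right h.le]
    constructor <;> nlinarith
  · rw [min_eq_right h.le, max_eq_left h.le]
    constructor <;> nlinarith

/-- An interval of length at most `2π` lies in one period, and the period can be moved to `(-π, π)`,
the angular range of polar coordinates. This lets arcs use any convenient angles. -/
lemma setLIntegral_periodic_le {G : ℝ → ℝ≥0∞} (hG : Function.Periodic G (2 * Real.pi))
    {α β : ℝ} (h : |β - α| ≤ 2 * Real.pi) :
    ∫⁻ θ in Set.Icc (min α β) (max α β), G θ ≤ ∫⁻ θ in Set.Ioo (-Real.pi) Real.pi, G θ := by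
  have hpi := Real.two_pi_pos
  have h1 : max α β ≤ min α β + 2 * Real.pi := by
    have := max_sub_min_eq_abs α β
    linarith
  have h2 : ∫⁻ θ in Set.Ioc (min α β) (min α β + 2 * Real.pi), G θ
      = ∫⁻ θ in Set.Ioc (-Real.pi) (-Real.pi + 2 * Real.pi), G θ :=
    (isAddFundamentalDomain_Ioc hpi _).setLIntegral_eq (isAddFundamentalDomain_Ioc hpi _) G
      hG.map_vadd_zmultiples
  have h3 : -Real.pi + 2 * Real.pi = Real.pi := by ring
  calc ∫⁻ θ in Set.Icc (min α β) (max α β), G θ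
      = ∫⁻ θ in Set.Ioc (min α β) (max α β), G θ := setLIntegral_congr Ioc_ae_eq_Icc.symm
    _ ≤ ∫⁻ θ in Set.Ioc (min α β) (min α β + 2 * Real.pi), G θ :=
        lintegral_mono_set (Set.Ioc_subset_Ioc_right h1)
    _ = ∫⁻ θ in Set.Ioo (-Real.pi) Real.pi, G θ := by
        rw [h2, h3]; exact setLIntegral_congr Ioo_ae_eq_Ioc.symm

/-- The infimum of the lengths of the arcs is at most the length of a whole circle. -/
lemma iInf_rhoLength_le {Ω A B : Set ℂ} {O : ℂ} {r : ℝ} (hr : 0 ≤ r) (h : HasArc Ω A B O r)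
    {ρ σ : ℂ → ℝ≥0∞} (hσ : ∀ z ∈ Ω, ρ z = σ z) :
    ⨅ γ ∈ arcFamily Ω A B, rhoLength ρ γ ≤
      ENNReal.ofReal r * ∫⁻ θ in Set.Ioo (-Real.pi) Real.pi, σ (circlePt O r θ) := by
  obtain ⟨α, β, hne, hle, hA, hB, hΩ⟩ := h
  have hmem : circArc O r α β ∈ arcFamily Ω A B := by
    refine ⟨lipschitz_circArc O hr α β, by simpa [circArc] using hA, by simpa [circArc] using hB,
      fun t ht => hΩ _ (lineMap_mem_Ioo hne ht)⟩
  refine (iInf₂_le _ hmem).trans ?_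
  have hinj : Set.InjOn (fun t : ℝ => α + t * (β - α)) (Set.Ioo 0 1) := by
    intro s _ t _ hst
    have : (s - t) * (β - α) = 0 := by
      have : α + s * (β - α) = α + t * (β - α) := hst
      linarith
    rcases mul_eq_zero.1 this with h | h
    · linarith
    · exact absurd (by linarith) hne
  have hder : ∀ x ∈ Set.Ioo (0 : ℝ) 1,
      HasDerivWithinAt (fun t : ℝ => α + t * (β - α)) (β - α) (Set.Ioo 0 1) x := by
    intro x _
    have : HasDerivAt (fun t : ℝ => α + t * (β - α)) (β - α) x := by
      simpa using ((hasDerivAt_id x).mul_const (β - α)).const_add α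
    exact this.hasDerivWithinAt
  -- Change of variables from the parameter `t` to the angle; the factor `|β - α|` is absorbed,
  -- whichever way the arc is run through.
  have hcv := lintegral_image_eq_lintegral_abs_deriv_mul measurableSet_Ioo hder hinj
    (fun θ => σ (circlePt O r θ))
  have hlen : rhoLength ρ (circArc O r α β) = ENNReal.ofReal r *
      ∫⁻ θ in (fun t : ℝ => α + t * (β - α)) '' Set.Ioo 0 1, σ (circlePt O r θ) := by
    rw [hcv, rhoLength, ← setLIntegral_congr Ioo_ae_eq_Icc,
      ← lintegral_const_mul' _ _ ENNReal.ofReal_ne_top]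
    refine setLIntegral_congr_fun measurableSet_Ioo fun t ht => ?_
    have h1 : ‖deriv (circArc O r α β) t‖ₑ = ENNReal.ofReal r * ENNReal.ofReal |β - α| := by
      rw [← ofReal_norm, norm_deriv_circArc O hr, mul_comm,
        ENNReal.ofReal_mul hr]
    have h2 : ρ (circArc O r α β t) = σ (circlePt O r (α + t * (β - α))) :=
      hσ _ (hΩ _ (lineMap_mem_Ioo hne ht))
    simp only [h1, h2]
    ring
  rw [hlen]
  refine mul_le_mul_right ?_ _
  refine (lintegral_mono_set (image_lineMap_Ioo_subset α β)).trans
    (setLIntegral_periodic_le (G := fun θ => σ (circlePt O r θ)) ?_ hle)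
  intro θ
  simp only [circlePt_periodic O r θ]

/-- Cauchy-Schwarz against the constant function `1`. -/
lemma sq_lintegral_le {μ : Measure ℝ} {G : ℝ → ℝ≥0∞} (hG : Measurable G) :
    (∫⁻ θ, G θ ∂μ) ^ 2 ≤ μ Set.univ * ∫⁻ θ, G θ ^ 2 ∂μ := by
  have h := ENNReal.lintegral_mul_le_Lp_mul_Lq μ (p := 2) (q := 2) Real.HolderConjugate.two_two
    (f := G) (g := fun _ => 1) hG.aemeasurable aemeasurable_const
  have h1 : (∫⁻ θ, G θ ∂μ) ≤ (∫⁻ θ, G θ ^ 2 ∂μ) ^ (1 / 2 : ℝ) * (μ Set.univ) ^ (1 / 2 : ℝ) := by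
    simpa using h
  calc (∫⁻ θ, G θ ∂μ) ^ 2
      ≤ ((∫⁻ θ, G θ ^ 2 ∂μ) ^ (1 / 2 : ℝ) * (μ Set.univ) ^ (1 / 2 : ℝ)) ^ 2 := by gcongr
    _ = μ Set.univ * ∫⁻ θ, G θ ^ 2 ∂μ := by
        rw [mul_pow, ← ENNReal.rpow_natCast, ← ENNReal.rpow_natCast, ← ENNReal.rpow_mul,
          ← ENNReal.rpow_mul, mul_comm]
        norm_num

lemma lintegral_inv_Ioo {ε R : ℝ} (hε : 0 < ε) (hR : ε < R) :
    ∫⁻ r in Set.Ioo ε R, ENNReal.ofReal r⁻¹ = ENNReal.ofReal (Real.log (R / ε)) := by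
  have hint : IntervalIntegrable (fun x : ℝ => x⁻¹) volume ε R := by
    refine intervalIntegral.intervalIntegrable_inv (fun x hx => ?_) continuousOn_id
    rw [Set.uIcc_of_le hR.le] at hx
    exact (hε.trans_le hx.1).ne'
  rw [setLIntegral_congr Ioo_ae_eq_Ioc, ← integral_inv_of_pos hε (hε.trans hR),
    intervalIntegral.integral_of_le hR.le, ofReal_integral_eq_lintegral_ofReal]
  · exact (intervalIntegrable_iff_integrableOn_Ioc_of_le hR.le).1 hint
  · refine (ae_restrict_iff' measurableSet_Ioc).2 (ae_of_all _ fun x hx => ?_)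
    exact inv_nonneg.2 (hε.trans hx.1).le

/-- Polar coordinates centred at `O`, restricted to an annulus; translation invariance moves the
centre to the origin. -/
lemma lintegral_circle_le {F : ℂ → ℝ≥0∞} (hF : Measurable F) (O : ℂ) {ε R : ℝ} (hε : 0 < ε) :
    ∫⁻ r in Set.Ioo ε R, ENNReal.ofReal r *
      ∫⁻ θ in Set.Ioo (-Real.pi) Real.pi, F (circlePt O r θ) ≤ ∫⁻ z, F z := by
  have hsub : Set.Ioo ε R ×ˢ Set.Ioo (-Real.pi) Real.pi ⊆ polarCoord.target := by
    rw [polarCoord_target]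
    exact Set.prod_mono (fun r hr => hε.trans hr.1) subset_rfl
  have hm : Measurable fun p : ℝ × ℝ => circlePt O p.1 p.2 := by
    unfold circlePt; fun_prop
  have hm' : Measurable fun p : ℝ × ℝ => ENNReal.ofReal p.1 * F (circlePt O p.1 p.2) :=
    (ENNReal.measurable_ofReal.comp measurable_fst).mul (hF.comp hm)
  calc _ = ∫⁻ r in Set.Ioo ε R, ∫⁻ θ in Set.Ioo (-Real.pi) Real.pi,
          ENNReal.ofReal r * F (circlePt O r θ) := by
        simp only [lintegral_const_mul' _ _ ENNReal.ofReal_ne_top]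
    _ = ∫⁻ p in Set.Ioo ε R ×ˢ Set.Ioo (-Real.pi) Real.pi,
          ENNReal.ofReal p.1 * F (circlePt O p.1 p.2) := by
        rw [Measure.volume_eq_prod, setLIntegral_prod _ hm'.aemeasurable]
    _ ≤ ∫⁻ p in polarCoord.target, ENNReal.ofReal p.1 * F (circlePt O p.1 p.2) :=
        lintegral_mono_set hsub
    _ = ∫⁻ z, F (O + z) := by
        rw [← Complex.lintegral_comp_polarCoord_symm]
        simp only [Complex.polarCoord_symm_apply, circlePt, smul_eq_mul]
    _ = ∫⁻ z, F z := lintegral_add_left_eq_self F O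

/-- If all the circles about `O` with radii between `ε` and `R` contain an arc of the family, then
the extremal length is at most `2π / log (R / ε)`. -/
theorem extremalLength_le_of_hasArc {Ω A B : Set ℂ} {O : ℂ} {ε R : ℝ} (hε : 0 < ε) (hR : ε < R)
    (h : ∀ r ∈ Set.Ioo ε R, HasArc Ω A B O r) :
    extremalLength Ω A B ≤ ENNReal.ofReal (2 * Real.pi) / ENNReal.ofReal (Real.log (R / ε)) := by
  refine iSup_le fun ρ => iSup_le fun hρ => iSup_le fun hpos => iSup_le fun hfin => ?_
  -- `Ω` is an arbitrary set, so `ρ` is cut off outside a measurable hull of `Ω`. The area is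
  -- unchanged and the resulting metric is Borel on the whole plane.
  set T := toMeasurable (volume : Measure ℂ) Ω with hT
  have hTm : MeasurableSet T := measurableSet_toMeasurable _ _
  set σ : ℂ → ℝ≥0∞ := T.indicator ρ with hσ
  have hσm : Measurable σ := hρ.indicator hTm
  have hσρ : ∀ z ∈ Ω, ρ z = σ z := fun z hz =>
    (Set.indicator_of_mem (subset_toMeasurable _ _ hz) ρ).symm
  have harea : ∫⁻ z, σ z ^ 2 = rhoArea Ω ρ := by
    rw [rhoArea, ← Measure.restrict_toMeasurable_of_sFinite, ← lintegral_indicator hTm]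
    congr 1
    funext z
    by_cases hz : z ∈ T <;> simp [hσ, hz]
  set L := ⨅ γ ∈ arcFamily Ω A B, rhoLength ρ γ with hL
  have hlog : 0 < Real.log (R / ε) := Real.log_pos ((one_lt_div hε).2 hR)
  have hmain : L ^ 2 * ENNReal.ofReal (Real.log (R / ε)) ≤
      ENNReal.ofReal (2 * Real.pi) * rhoArea Ω ρ := by
    -- On each circle `L ≤ r ∫ σ dθ`, hence `L² / r ≤ 2π r ∫ σ² dθ`. Integrating over `ε < r < R`
    -- gives the logarithm on the left and at most `2π` times the area on the right.
    calc L ^ 2 * ENNReal.ofReal (Real.log (R / ε))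
        = ∫⁻ r in Set.Ioo ε R, L ^ 2 * ENNReal.ofReal r⁻¹ := by
          rw [lintegral_const_mul _ (by fun_prop), lintegral_inv_Ioo hε hR]
      _ ≤ ∫⁻ r in Set.Ioo ε R, ENNReal.ofReal (2 * Real.pi) * (ENNReal.ofReal r *
            ∫⁻ θ in Set.Ioo (-Real.pi) Real.pi, σ (circlePt O r θ) ^ 2) := by
          refine setLIntegral_mono' measurableSet_Ioo fun r hr => ?_
          have hr0 : 0 < r := hε.trans hr.1
          have h1 := iInf_rhoLength_le hr0.le (h r hr) hσρ
          have h2 := sq_lintegral_le (μ := volume.restrict (Set.Ioo (-Real.pi) Real.pi))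
            (hσm.comp (continuous_circlePt O r).measurable)
          have hvol : (volume.restrict (Set.Ioo (-Real.pi) Real.pi)) Set.univ =
              ENNReal.ofReal (2 * Real.pi) := by
            rw [Measure.restrict_apply_univ, Real.volume_Ioo]
            congr 1
            ring
          rw [hvol] at h2
          have h3 : ENNReal.ofReal r * ENNReal.ofReal r⁻¹ = 1 := by
            rw [← ENNReal.ofReal_mul hr0.le, mul_inv_cancel₀ hr0.ne', ENNReal.ofReal_one]
          calc L ^ 2 * ENNReal.ofReal r⁻¹
              ≤ (ENNReal.ofReal r *
                  ∫⁻ θ in Set.Ioo (-Real.pi) Real.pi, σ (circlePt O r θ)) ^ 2 *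
                  ENNReal.ofReal r⁻¹ := by gcongr
            _ = (ENNReal.ofReal r * ENNReal.ofReal r⁻¹) * ENNReal.ofReal r *
                  (∫⁻ θ in Set.Ioo (-Real.pi) Real.pi, σ (circlePt O r θ)) ^ 2 := by ring
            _ ≤ 1 * ENNReal.ofReal r * (ENNReal.ofReal (2 * Real.pi) *
                  ∫⁻ θ in Set.Ioo (-Real.pi) Real.pi, σ (circlePt O r θ) ^ 2) := by
                rw [h3]
                gcongr
                exact h2
            _ = _ := by ring
      _ = ENNReal.ofReal (2 * Real.pi) * ∫⁻ r in Set.Ioo ε R, (ENNReal.ofReal r *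
            ∫⁻ θ in Set.Ioo (-Real.pi) Real.pi, σ (circlePt O r θ) ^ 2) :=
          lintegral_const_mul' _ _ ENNReal.ofReal_ne_top
      _ ≤ ENNReal.ofReal (2 * Real.pi) * rhoArea Ω ρ := by
          rw [← harea]
          gcongr
          exact lintegral_circle_le (hσm.pow_const 2) O hε
  rw [ENNReal.div_le_iff hpos.ne' hfin.ne, mul_comm, ← mul_div_assoc, mul_comm (rhoArea Ω ρ),
    ENNReal.le_div_iff_mul_le (Or.inl (ENNReal.ofReal_pos.2 hlog).ne')
      (Or.inl ENNReal.ofReal_ne_top)]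
  exact hmain

/-- Extremal lengths tend to zero if there are arcs in circular annuli of arbitrarily large
modulus. -/
theorem tendsto_extremalLength_zero {X : Type*} {F : Filter X} {Ω A B : X → Set ℂ}
    (h : ∀ M : ℝ, 1 < M → ∃ ε > 0, ∀ᶠ x in F, ∃ O : ℂ, ∀ r ∈ Set.Ioo ε (M * ε),
      HasArc (Ω x) (A x) (B x) O r) :
    Tendsto (fun x => extremalLength (Ω x) (A x) (B x)) F (𝓝 0) := by
  rw [ENNReal.tendsto_nhds_zero]
  intro η hη
  have hlim : Tendsto (fun M : ℝ => ENNReal.ofReal (2 * Real.pi) / ENNReal.ofReal (Real.log M))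
      atTop (𝓝 0) := by
    have := ENNReal.Tendsto.const_div (a := ENNReal.ofReal (2 * Real.pi))
      (ENNReal.tendsto_ofReal_atTop.comp Real.tendsto_log_atTop) (Or.inr ENNReal.ofReal_ne_top)
    simpa [Function.comp_def] using this
  obtain ⟨M, hM, hM1⟩ := ((ENNReal.tendsto_nhds_zero.1 hlim η hη).and
    (eventually_gt_atTop 1)).exists
  obtain ⟨ε, hε, hev⟩ := h M hM1
  filter_upwards [hev] with x ⟨O, hO⟩
  refine (extremalLength_le_of_hasArc hε (by nlinarith) hO).trans ?_
  rwa [mul_div_cancel_right₀ _ hε.ne']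

/-! ### The order geometry of the zigzag -/

variable {g : ℕ}

lemma vertex_zero (l : Fin g → ℝ) : vertex l 0 = ⟨0, -cornerSize l⟩ := by simp [vertex]

lemma vertex_succ (l : Fin g → ℝ) (k : ℕ) :
    vertex l (k + 1) = vertex l k + (edgeLen l k : ℂ) * (if Even k then 1 else Complex.I) := by
  simp only [vertex, Finset.sum_range_succ]
  ring

lemma vertex_succ_re (l : Fin g → ℝ) (k : ℕ) :
    (vertex l (k + 1)).re = (vertex l k).re + if Even k then edgeLen l k else 0 := by
  rw [vertex_succ]
  split_ifs <;> simp

lemma vertex_succ_im (l : Fin g → ℝ) (k : ℕ) :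
    (vertex l (k + 1)).im = (vertex l k).im + if Even k then 0 else edgeLen l k := by
  rw [vertex_succ]
  split_ifs <;> simp

lemma edgeLen_nonneg {l : Fin g → ℝ} (hl : ∀ i, 0 ≤ l i) (j : ℕ) : 0 ≤ edgeLen l j := by
  unfold edgeLen
  split_ifs <;> first | exact hl _ | exact le_rfl

lemma monotone_vertex_re {l : Fin g → ℝ} (hl : ∀ i, 0 ≤ l i) :
    Monotone fun k => (vertex l k).re := by
  refine monotone_nat_of_le_succ fun k => ?_
  rw [vertex_succ_re]
  have := edgeLen_nonneg hl k
  split_ifs <;> linarith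

lemma monotone_vertex_im {l : Fin g → ℝ} (hl : ∀ i, 0 ≤ l i) :
    Monotone fun k => (vertex l k).im := by
  refine monotone_nat_of_le_succ fun k => ?_
  rw [vertex_succ_im]
  have := edgeLen_nonneg hl k
  split_ifs <;> linarith

lemma edgeLen_reflect (l : Fin g → ℝ) {j : ℕ} (hj : j < g) :
    edgeLen l (2 * g - 1 - j) = edgeLen l j := by
  have h1 : ¬ 2 * g - 1 - j < g := by omega
  have h2 : 2 * g - 1 - j < 2 * g := by omega
  have h3 : 2 * g - 1 - (2 * g - 1 - j) = j := by omega
  simp [edgeLen, hj, h1, h2, h3]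

lemma sum_edgeLen (l : Fin g → ℝ) : ∑ j ∈ Finset.range g, edgeLen l j = cornerSize l := by
  rw [cornerSize, Finset.sum_range]
  exact Finset.sum_congr rfl fun i _ => by simp [edgeLen]

/-- The steps `j` and `2g - 1 - j` have equal length and opposite parity, so one is horizontal and
the other vertical: each such pair contributes `ℓ_j (1 + i)`. -/
lemma vertex_two_mul (l : Fin g → ℝ) : vertex l (2 * g) = ⟨cornerSize l, 0⟩ := by
  have hsplit : ∑ j ∈ Finset.range (2 * g),
      (edgeLen l j : ℂ) * (if Even j then 1 else Complex.I) =
      ∑ j ∈ Finset.range g, (edgeLen l j : ℂ) * (1 + Complex.I) := by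
    have h1 : ∑ j ∈ Finset.range g,
        (edgeLen l (g + j) : ℂ) * (if Even (g + j) then 1 else Complex.I) =
        ∑ j ∈ Finset.range g, (edgeLen l j : ℂ) * (if Even j then Complex.I else 1) := by
      rw [← Finset.sum_range_reflect]
      refine Finset.sum_congr rfl fun j hj => ?_
      have hj := Finset.mem_range.1 hj
      have h2 : g + (g - 1 - j) = 2 * g - 1 - j := by omega
      have h3 : Even (2 * g - 1 - j) ↔ ¬ Even j := by
        rw [Nat.even_iff, Nat.even_iff]
        omega
      rw [h2, edgeLen_reflect l hj]
      by_cases h : Even j <;> simp [h3, h]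
    rw [two_mul, Finset.sum_range_add, h1, ← Finset.sum_add_distrib]
    refine Finset.sum_congr rfl fun j _ => ?_
    split_ifs <;> ring
  rw [vertex, hsplit, ← Finset.sum_mul, ← Complex.ofReal_sum, sum_edgeLen]
  apply Complex.ext <;> simp

/-- Every step raises `x + y` by its length, and the first `g` lengths add up to `a`, starting from
`x + y = -a`. -/
lemma vertex_re_add_im (l : Fin g → ℝ) :
    (vertex l g).re + (vertex l g).im = 0 := by
  have h : ∀ k, (vertex l k).re + (vertex l k).im =
      -cornerSize l + ∑ j ∈ Finset.range k, edgeLen l j := by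
    intro k
    induction k with
    | zero => simp [vertex_zero]
    | succ k ih =>
      rw [vertex_succ_re, vertex_succ_im, Finset.sum_range_succ]
      split_ifs <;> linarith
  rw [h, sum_edgeLen]
  ring

lemma mem_segment_re_im {z u v : ℂ} (hre : u.re ≤ v.re) (him : u.im ≤ v.im)
    (h : z ∈ segment ℝ u v) :
    (u.re ≤ z.re ∧ u.im ≤ z.im) ∧ (z.re ≤ v.re ∧ z.im ≤ v.im) := by
  obtain ⟨a, b, ha, hb, hab, rfl⟩ := h
  obtain rfl : a = 1 - b := by linarith
  simp only [Complex.add_re, Complex.add_im, Complex.real_smul, Complex.re_ofReal_mul,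
    Complex.im_ofReal_mul]
  refine ⟨⟨?_, ?_⟩, ?_, ?_⟩ <;> nlinarith

lemma segment_chain {z w u v : ℂ} (hre : u.re ≤ v.re) (him : u.im ≤ v.im)
    (hz : z ∈ segment ℝ u v) (hw : w ∈ segment ℝ u v) :
    (z.re ≤ w.re ∧ z.im ≤ w.im) ∨ (w.re ≤ z.re ∧ w.im ≤ z.im) := by
  rw [segment_eq_image'] at hz hw
  obtain ⟨s, hs, rfl⟩ := hz
  obtain ⟨t, ht, rfl⟩ := hw
  simp only [Complex.add_re, Complex.add_im, Complex.real_smul, Complex.re_ofReal_mul,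
    Complex.im_ofReal_mul, Complex.sub_re, Complex.sub_im]
  rcases le_total s t with h | h
  · left; constructor <;> nlinarith
  · right; constructor <;> nlinarith

lemma mem_zigzag_cases {l : Fin g → ℝ} {z : ℂ} (hz : z ∈ zigzag l) :
    (z.re = 0 ∧ z.im ≤ -cornerSize l) ∨
      (∃ k < 2 * g, z ∈ segment ℝ (vertex l k) (vertex l (k + 1))) ∨
      (z.im = 0 ∧ cornerSize l ≤ z.re) := by
  rcases hz with (h | h) | h
  · exact Or.inl h
  · simp only [Finset.mem_range, Set.mem_iUnion, exists_prop] at h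
    exact Or.inr (Or.inl h)
  · exact Or.inr (Or.inr h)

/-- The points of the zigzag are totally ordered by the coordinatewise order. -/
lemma zigzag_chain {l : Fin g → ℝ} (hl : ∀ i, 0 ≤ l i) {z w : ℂ} (hz : z ∈ zigzag l)
    (hw : w ∈ zigzag l) :
    (z.re ≤ w.re ∧ z.im ≤ w.im) ∨ (w.re ≤ z.re ∧ w.im ≤ z.im) := by
  have hre := monotone_vertex_re hl
  have him := monotone_vertex_im hl
  have ha : 0 ≤ cornerSize l := Finset.sum_nonneg fun i _ => hl i
  have hseg : ∀ {k z}, z ∈ segment ℝ (vertex l k) (vertex l (k + 1)) →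
      ((vertex l k).re ≤ z.re ∧ (vertex l k).im ≤ z.im) ∧
        (z.re ≤ (vertex l (k + 1)).re ∧ z.im ≤ (vertex l (k + 1)).im) := fun h =>
    mem_segment_re_im (hre (Nat.le_succ _)) (him (Nat.le_succ _)) h
  have hlow : ∀ {k z}, k < 2 * g → z ∈ segment ℝ (vertex l k) (vertex l (k + 1)) →
      0 ≤ z.re ∧ -cornerSize l ≤ z.im ∧ z.re ≤ cornerSize l ∧ z.im ≤ 0 := by
    intro k z hk h
    have h1 := hseg h
    have h2 := hre (Nat.zero_le k)
    have h3 := him (Nat.zero_le k)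
    have h4 := hre (Nat.succ_le_of_lt hk)
    have h5 := him (Nat.succ_le_of_lt hk)
    simp only [vertex_zero, vertex_two_mul, Nat.succ_eq_add_one] at h2 h3 h4 h5
    refine ⟨?_, ?_, ?_, ?_⟩ <;> linarith [h1.1.1, h1.1.2, h1.2.1, h1.2.2]
  rcases mem_zigzag_cases hz with ⟨h1, h2⟩ | ⟨k, hk, h1⟩ | ⟨h1, h2⟩ <;>
  rcases mem_zigzag_cases hw with ⟨h3, h4⟩ | ⟨k', hk', h3⟩ | ⟨h3, h4⟩
  · rcases le_total z.im w.im with h | h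
    · exact Or.inl ⟨by linarith, h⟩
    · exact Or.inr ⟨by linarith, h⟩
  · have := hlow hk' h3
    exact Or.inl ⟨by linarith, by linarith⟩
  · exact Or.inl ⟨by linarith, by linarith⟩
  · have := hlow hk h1
    exact Or.inr ⟨by linarith, by linarith⟩
  · rcases lt_trichotomy k k' with h | rfl | h
    · have h5 := hre (Nat.succ_le_of_lt h)
      have h6 := him (Nat.succ_le_of_lt h)
      simp only [Nat.succ_eq_add_one] at h5 h6
      have := hseg h1
      have := hseg h3
      exact Or.inl ⟨by linarith, by linarith⟩
    · exact segment_chain (hre (Nat.le_succ _)) (him (Nat.le_succ _)) h1 h3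
    · have h5 := hre (Nat.succ_le_of_lt h)
      have h6 := him (Nat.succ_le_of_lt h)
      simp only [Nat.succ_eq_add_one] at h5 h6
      have := hseg h1
      have := hseg h3
      exact Or.inr ⟨by linarith, by linarith⟩
  · have := hlow hk h1
    exact Or.inl ⟨by linarith, by linarith⟩
  · exact Or.inr ⟨by linarith, by linarith⟩
  · have := hlow hk' h3
    exact Or.inr ⟨by linarith, by linarith⟩
  · rcases le_total z.re w.re with h | h
    · exact Or.inl ⟨h, by linarith⟩
    · exact Or.inr ⟨h, by linarith⟩

/-- A point strictly to the upper left of `w` is incomparable with `w`, so it cannot belong to the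
chain. Membership is thereby reduced to exhibiting one zigzag point. -/
lemma mem_upperLeft {l : Fin g → ℝ} (hl : ∀ i, 0 ≤ l i) {b : ℝ} {z w : ℂ} (hw : w ∈ zigzag l)
    (hre : z.re < w.re) (him : w.im < z.im) (h1 : -b < z.re) (h2 : z.im < b) :
    z ∈ orthodisk .upperLeft (l, b) := by
  refine ⟨fun hz => ?_, ⟨w, hw, hre.le, him.le⟩, h1, h2⟩
  rcases zigzag_chain hl hz hw with h | h
  · linarith [h.2]
  · linarith [h.1]

lemma mem_lowerRight {l : Fin g → ℝ} (hl : ∀ i, 0 ≤ l i) {b : ℝ} {z w : ℂ} (hw : w ∈ zigzag l)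
    (hre : w.re < z.re) (him : z.im < w.im) (h1 : z.re < b) :
    z ∈ orthodisk .lowerRight (l, b) := by
  refine ⟨fun hz => ?_, ⟨w, hw, hre.le, him.le⟩, Or.inl h1⟩
  rcases zigzag_chain hl hz hw with h | h
  · linarith [h.1]
  · linarith [h.2]

/-! ### Points on the edges and their directions from a vertex -/

/-- The length of the edge number `k`, cut off to `1` for the two infinite edges of the zigzag. -/
def fullLen (l : Fin g → ℝ) (k : ℕ) : ℝ :=
  if k = 0 ∨ k = 2 * g + 1 then 1 else edgeLen l (k - 1)

/-- The direction of the edge number `k` of the zigzag. -/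
def edgeDir (k : ℕ) : ℂ := if Even k then Complex.I else 1

lemma vertex_eq_add (l : Fin g → ℝ) {k : ℕ} (hk : 1 ≤ k) :
    vertex l k = vertex l (k - 1) + (edgeLen l (k - 1) : ℂ) * edgeDir k := by
  obtain ⟨k, rfl⟩ := Nat.exists_eq_add_of_le' hk
  rw [vertex_succ, Nat.add_sub_cancel, edgeDir]
  by_cases h : Even k <;> simp [h, Nat.even_add_one]

lemma add_mem_openSegment_vertex (l : Fin g → ℝ) {k : ℕ} (hk : 1 ≤ k) {t : ℝ} (ht : 0 < t)
    (ht' : t < edgeLen l (k - 1)) :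
    vertex l (k - 1) + (t : ℂ) * edgeDir k ∈ openSegment ℝ (vertex l (k - 1)) (vertex l k) := by
  have hpos := ht.trans ht'
  rw [openSegment_eq_image', vertex_eq_add l hk]
  refine ⟨t / edgeLen l (k - 1), ⟨by positivity, (div_lt_one hpos).2 ht'⟩, ?_⟩
  have : ((edgeLen l (k - 1) : ℝ) : ℂ) ≠ 0 := by exact_mod_cast hpos.ne'
  simp only [Complex.real_smul]
  push_cast
  field_simp
  ring

lemma openSegment_vertex_subset (l : Fin g → ℝ) {k : ℕ} (hk : 1 ≤ k) (hk' : k ≤ 2 * g) :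
    openSegment ℝ (vertex l (k - 1)) (vertex l k) ⊆ zigzag l := by
  intro z hz
  refine Or.inl (Or.inr ?_)
  simp only [Finset.mem_range, Set.mem_iUnion, exists_prop]
  refine ⟨k - 1, by omega, ?_⟩
  rw [Nat.sub_add_cancel hk]
  exact openSegment_subset_segment _ _ _ hz

lemma vertex_mem_zigzag (l : Fin g → ℝ) {k : ℕ} (hk : k ≤ 2 * g) : vertex l k ∈ zigzag l := by
  rcases Nat.eq_zero_or_pos k with rfl | h
  · left; left
    simp [vertex_zero]
  · refine Or.inl (Or.inr ?_)
    simp only [Finset.mem_range, Set.mem_iUnion, exists_prop]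
    refine ⟨k - 1, by omega, ?_⟩
    rw [Nat.sub_add_cancel h]
    exact right_mem_segment _ _ _

lemma edge_eq_openSegment (s : Side) (x : (Fin g → ℝ) × ℝ) {k : ℕ} (hk : 1 ≤ k)
    (hk' : k ≤ 2 * g) : edge s x k = openSegment ℝ (vertex x.1 (k - 1)) (vertex x.1 k) := by
  unfold edge
  rw [if_neg (by omega), if_pos hk']

/-- The point is also recorded as a zigzag point because the endpoint of an arc later serves as the
witness `w` in `mem_upperLeft` and `mem_lowerRight`. -/
lemma sub_mem_edge (s : Side) (x : (Fin g → ℝ) × ℝ) {k : ℕ} (hk : k ≤ 2 * g) {t : ℝ}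
    (ht : 0 < t) (ht' : t < fullLen x.1 k) :
    vertex x.1 k - (t : ℂ) * edgeDir k ∈ edge s x k ∩ zigzag x.1 := by
  rcases Nat.eq_zero_or_pos k with rfl | h
  · refine ⟨?_, Or.inl (Or.inl ?_)⟩ <;> simp [edge, vertex_zero, edgeDir, ht, ht.le]
  · have hL : fullLen x.1 k = edgeLen x.1 (k - 1) := by
      rw [fullLen, if_neg (by omega)]
    rw [hL] at ht'
    have h1 := add_mem_openSegment_vertex x.1 h (t := edgeLen x.1 (k - 1) - t) (by linarith)
      (by linarith)
    have h2 : vertex x.1 (k - 1) + ((edgeLen x.1 (k - 1) - t : ℝ) : ℂ) * edgeDir k =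
        vertex x.1 k - (t : ℂ) * edgeDir k := by
      rw [vertex_eq_add x.1 h]
      push_cast
      ring
    rw [h2] at h1
    exact ⟨by rwa [edge_eq_openSegment s x h hk], openSegment_vertex_subset x.1 h hk h1⟩

lemma add_mem_edge (s : Side) (x : (Fin g → ℝ) × ℝ) {k : ℕ} (hk : 1 ≤ k) (hk' : k ≤ 2 * g + 1)
    {t : ℝ} (ht : 0 < t) (ht' : t < fullLen x.1 k) :
    vertex x.1 (k - 1) + (t : ℂ) * edgeDir k ∈ edge s x k ∩ zigzag x.1 := by
  rcases hk'.eq_or_lt with rfl | h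
  · refine ⟨?_, Or.inr ?_⟩ <;>
      simp [edge, vertex_two_mul, edgeDir, ht, ht.le]
  · have hL : fullLen x.1 k = edgeLen x.1 (k - 1) := by
      rw [fullLen, if_neg (by omega)]
    rw [hL] at ht'
    have h1 := add_mem_openSegment_vertex x.1 hk ht ht'
    have hk2 : k ≤ 2 * g := by omega
    exact ⟨by rwa [edge_eq_openSegment s x hk hk2], openSegment_vertex_subset x.1 hk hk2 h1⟩

lemma exists_angle {e : ℂ} {r : ℝ} (hr : 0 < r) (hre : 0 ≤ e.re) (him : 0 ≤ e.im)
    (h : e.re ^ 2 + e.im ^ 2 = r ^ 2) :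
    ∃ β, 0 ≤ β ∧ β ≤ Real.pi / 2 ∧ r * Real.cos β = e.re ∧ r * Real.sin β = e.im := by
  have h1 : 0 ≤ e.im / r := by positivity
  have h2 : e.im / r ≤ 1 := (div_le_one hr).2 (by nlinarith)
  have hcos : r * Real.cos (Real.arcsin (e.im / r)) = e.re := by
    rw [Real.cos_arcsin, ← Real.sqrt_sq hr.le, ← Real.sqrt_mul (sq_nonneg _), Real.sqrt_sq hr.le,
      mul_sub, ← mul_pow, mul_div_cancel₀ _ hr.ne', mul_one, ← h, add_sub_cancel_right,
      Real.sqrt_sq hre]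
  refine ⟨Real.arcsin (e.im / r), Real.arcsin_nonneg.2 h1, Real.arcsin_le_pi_div_two _, hcos, ?_⟩
  rw [Real.sin_arcsin (by linarith) h2, mul_div_cancel₀ _ hr.ne']

/-- The direction in which the edge number `k` is seen from its second endpoint. -/
noncomputable def backAngle (k : ℕ) : ℝ := if Even k then 3 * Real.pi / 2 else Real.pi

lemma cos_three_pi_div_two : Real.cos (3 * Real.pi / 2) = 0 := by
  rw [show 3 * Real.pi / 2 = Real.pi / 2 + Real.pi by ring, Real.cos_add_pi, Real.cos_pi_div_two,
    neg_zero]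

lemma sin_three_pi_div_two : Real.sin (3 * Real.pi / 2) = -1 := by
  rw [show 3 * Real.pi / 2 = Real.pi / 2 + Real.pi by ring, Real.sin_add_pi, Real.sin_pi_div_two]

lemma circlePt_backAngle (O : ℂ) (r : ℝ) (k : ℕ) :
    circlePt O r (backAngle k) = O - (r : ℂ) * edgeDir k := by
  unfold backAngle edgeDir
  split_ifs <;> apply Complex.ext <;> simp [cos_three_pi_div_two, sin_three_pi_div_two] <;> ring

lemma pi_le_backAngle (k : ℕ) : Real.pi ≤ backAngle k := by
  have := Real.pi_pos
  unfold backAngle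
  split_ifs <;> linarith

lemma backAngle_le (k : ℕ) : backAngle k ≤ 3 * Real.pi / 2 := by
  have := Real.pi_pos
  unfold backAngle
  split_ifs <;> linarith

/-- The intersection of a circle about `P_m` with an edge further along the zigzag. -/
lemma exists_mem_edge_circle (s : Side) (x : (Fin g → ℝ) × ℝ) (hl : ∀ i, 0 ≤ x.1 i) {m n : ℕ}
    (hmn : m < n) (hn : n ≤ 2 * g + 1) {r : ℝ}
    (hr : (vertex x.1 (n - 1)).re - (vertex x.1 m).re +
      ((vertex x.1 (n - 1)).im - (vertex x.1 m).im) < r) (hrn : r < fullLen x.1 n) :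
    ∃ e : ℂ, 0 ≤ e.re ∧ 0 ≤ e.im ∧ e.re ^ 2 + e.im ^ 2 = r ^ 2 ∧
      vertex x.1 m + e ∈ edge s x n ∩ zigzag x.1 := by
  have hp := monotone_vertex_re hl (show m ≤ n - 1 by omega)
  have hq := monotone_vertex_im hl (show m ≤ n - 1 by omega)
  simp only at hp hq
  set d := vertex x.1 (n - 1) - vertex x.1 m with hd
  have hdp : 0 ≤ d.re := by simp [hd, hp]
  have hdq : 0 ≤ d.im := by simp [hd, hq]
  have hdr : d.re + d.im < r := by simpa [hd] using hr
  have key : ∀ u v : ℝ, 0 ≤ u → 0 ≤ v → u + v < r →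
      u < Real.sqrt (r ^ 2 - v ^ 2) ∧ Real.sqrt (r ^ 2 - v ^ 2) ≤ r ∧
      Real.sqrt (r ^ 2 - v ^ 2) ^ 2 = r ^ 2 - v ^ 2 := by
    intro u v hu hv h
    refine ⟨Real.lt_sqrt_of_sq_lt (by nlinarith), ?_, Real.sq_sqrt (by nlinarith)⟩
    exact Real.sqrt_le_iff.2 ⟨by linarith, by nlinarith⟩
  -- The circle is cut with the line of the edge. As `d.re + d.im < r`, the point `d` is inside the
  -- circle, so the intersection lies beyond the first endpoint; its distance from there is at most
  -- `r`, hence less than the length of the edge.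
  by_cases hev : Even n
  · obtain ⟨h1, h2, h3⟩ := key d.im d.re hdq hdp (by linarith)
    refine ⟨⟨d.re, Real.sqrt (r ^ 2 - d.re ^ 2)⟩, hdp, Real.sqrt_nonneg _, ?_, ?_⟩
    · simp only [h3]; ring
    · have := add_mem_edge s x (k := n) (by omega) hn
        (t := Real.sqrt (r ^ 2 - d.re ^ 2) - d.im) (by linarith) (by linarith)
      convert this using 1
      apply Complex.ext <;> simp [hd, edgeDir, hev]
      ring
  · obtain ⟨h1, h2, h3⟩ := key d.re d.im hdp hdq (by linarith)
    refine ⟨⟨Real.sqrt (r ^ 2 - d.im ^ 2), d.im⟩, Real.sqrt_nonneg _, hdq, ?_, ?_⟩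
    · simp only [h3]; ring
    · have := add_mem_edge s x (k := n) (by omega) hn
        (t := Real.sqrt (r ^ 2 - d.im ^ 2) - d.re) (by linarith) (by linarith)
      convert this using 1
      apply Complex.ext <;> simp [hd, edgeDir, hev]
      ring

/-! ### Circular arcs inside the orthodisks -/

/-- In the upper left orthodisk, two edges of the zigzag are joined by arcs about an endpoint of
the first one. -/
lemma hasArc_upperLeft {x : (Fin g → ℝ) × ℝ} (hl : ∀ i, 0 ≤ x.1 i) {m n : ℕ} (hmn : m < n)
    (hn : n ≤ 2 * g + 1) {r : ℝ}
    (hr : (vertex x.1 (n - 1)).re - (vertex x.1 m).re +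
      ((vertex x.1 (n - 1)).im - (vertex x.1 m).im) < r) (hr0 : 0 < r)
    (hrm : r < fullLen x.1 m) (hrn : r < fullLen x.1 n) (hrb : r < x.2) :
    HasArc (orthodisk .upperLeft x) (edge .upperLeft x m) (edge .upperLeft x n)
      (vertex x.1 m) r := by
  obtain ⟨e, he1, he2, he3, he4⟩ := exists_mem_edge_circle .upperLeft x hl hmn hn hr hrn
  obtain ⟨β, hβ0, hβ1, hc, hs⟩ := exists_angle hr0 he1 he2 he3
  have hpi := Real.pi_pos
  have hβe : circlePt (vertex x.1 m) r β = vertex x.1 m + e := by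
    apply Complex.ext <;> simp [hc, hs]
  have hα1 := pi_le_backAngle m
  have hα2 := backAngle_le m
  have hstart := sub_mem_edge .upperLeft x (k := m) (by omega) hr0 hrm
  rw [← circlePt_backAngle] at hstart
  have hOre : 0 ≤ (vertex x.1 m).re := by
    simpa [vertex_zero] using monotone_vertex_re hl (Nat.zero_le m)
  have hOim : (vertex x.1 m).im ≤ 0 := by
    simpa [vertex_two_mul] using monotone_vertex_im hl (show m ≤ 2 * g by omega)
  refine ⟨backAngle m, β, by linarith, ?_, hstart.1, by rw [hβe]; exact he4.1, ?_⟩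
  · rw [abs_le]; constructor <;> linarith
  · rintro θ ⟨h1, h2⟩
    rw [min_eq_right (by linarith)] at h1
    rw [max_eq_left (by linarith)] at h2
    have hcos1 := Real.neg_one_le_cos θ
    have hsin1 := Real.sin_le_one θ
    have hb1 : -x.2 < (circlePt (vertex x.1 m) r θ).re := by
      rw [circlePt_re]; nlinarith
    have hb2 : (circlePt (vertex x.1 m) r θ).im < x.2 := by
      rw [circlePt_im]; nlinarith
    -- One zigzag point per quadrant shows that the arc is on the upper left: its endpoint on the
    -- edge `n` in the first quadrant, the centre `P_m` in the second, and the starting point on the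
    -- edge `m` in the third.
    rcases le_or_gt θ (Real.pi / 2) with h3 | h3
    · refine mem_upperLeft hl he4.2 ?_ ?_ hb1 hb2
      · have := Real.cos_lt_cos_of_nonneg_of_le_pi_div_two hβ0 h3 h1
        rw [circlePt_re, Complex.add_re, ← hc]
        nlinarith
      · have := Real.sin_lt_sin_of_lt_of_le_pi_div_two (by linarith) h3 h1
        rw [circlePt_im, Complex.add_im, ← hs]
        nlinarith
    · have hcos : Real.cos θ < 0 := Real.cos_neg_of_pi_div_two_lt_of_lt h3 (by linarith)
      rcases lt_or_ge θ Real.pi with h4 | h4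
      · have hsin : 0 < Real.sin θ := Real.sin_pos_of_pos_of_lt_pi (by linarith) h4
        refine mem_upperLeft hl (vertex_mem_zigzag x.1 (k := m) (by omega)) ?_ ?_ hb1 hb2
        · rw [circlePt_re]; nlinarith
        · rw [circlePt_im]; nlinarith
      · have hα : backAngle m = 3 * Real.pi / 2 := by
          unfold backAngle at h2 ⊢
          split_ifs at h2 ⊢ with h
          · rfl
          · linarith
        refine mem_upperLeft hl hstart.2 ?_ ?_ hb1 hb2
        · rw [circlePt_re, circlePt_re, hα, cos_three_pi_div_two]; nlinarith
        · have h5 : Real.sin (θ - Real.pi) < Real.sin (Real.pi / 2) :=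
            Real.sin_lt_sin_of_lt_of_le_pi_div_two (by linarith) le_rfl (by linarith)
          rw [Real.sin_sub_pi, Real.sin_pi_div_two] at h5
          rw [circlePt_im, circlePt_im, hα, sin_three_pi_div_two]; nlinarith

/-- In the lower right orthodisk, the edges `P_{k-1} P_k` with `k ≤ g` are joined to the edge
`V E_2` by arcs about `P_k`. -/
lemma hasArc_lowerRight {x : (Fin g → ℝ) × ℝ} (hl : ∀ i, 0 ≤ x.1 i) (hb : diagCoord x.1 < x.2)
    {k : ℕ} (hk : 1 ≤ k) (hkg : k ≤ g) {r : ℝ} (hr : 2 * (x.2 - (vertex x.1 k).re) < r)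
    (hr' : r < edgeLen x.1 (k - 1)) :
    HasArc (orthodisk .lowerRight x) (edge .lowerRight x k) (edge .lowerRight x (2 * g + 3))
      (vertex x.1 k) r := by
  have hpi := Real.pi_pos
  have hre : (vertex x.1 k).re ≤ diagCoord x.1 := monotone_vertex_re hl hkg
  have him : (vertex x.1 k).im ≤ -diagCoord x.1 := by
    have h1 : (vertex x.1 k).im ≤ (vertex x.1 g).im := monotone_vertex_im hl hkg
    have h2 := vertex_re_add_im x.1
    have h3 : diagCoord x.1 = (vertex x.1 g).re := rfl
    linarith
  set δ := x.2 - (vertex x.1 k).re with hδ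
  have hδ0 : 0 < δ := by linarith
  have hr0 : 0 < r := by linarith
  have hδr : δ / r < 1 := (div_lt_one hr0).2 (by linarith)
  have hδr0 : 0 < δ / r := by positivity
  -- The arc ends where the circle meets `x = b` below the centre, at the angle `φ` past the
  -- downward direction.
  set φ := Real.arcsin (δ / r) with hφ
  have hφ0 : 0 < φ := Real.arcsin_pos.2 hδr0
  have hφ1 : φ < Real.pi / 2 := Real.arcsin_lt_pi_div_two.2 hδr
  have hsinφ : r * Real.sin φ = δ := by
    rw [hφ, Real.sin_arcsin (by linarith) hδr.le, mul_div_cancel₀ _ hr0.ne']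
  -- Because `r > 2δ`, the drop `r cos φ` exceeds `δ`. With `Im P_k ≤ -c ≤ -Re P_k` this puts the
  -- endpoint below `y = -b`, that is, on the edge `V E_2` and not above `V`.
  have hcosφ : δ < r * Real.cos φ := by
    have h1 : 0 < Real.cos φ := Real.cos_pos_of_mem_Ioo ⟨by linarith, hφ1⟩
    have h2 := Real.sin_sq_add_cos_sq φ
    have h3 : δ ^ 2 < (r * Real.cos φ) ^ 2 := by
      have : (r * Real.cos φ) ^ 2 = r ^ 2 - δ ^ 2 := by rw [← hsinφ]; linear_combination r ^ 2 * h2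
      rw [this]; nlinarith
    exact lt_of_pow_lt_pow_left₀ 2 (by positivity) h3
  have hcos : ∀ ψ, Real.cos (3 * Real.pi / 2 + ψ) = Real.sin ψ := fun ψ => by
    rw [Real.cos_add, cos_three_pi_div_two, sin_three_pi_div_two]; ring
  have hsin : ∀ ψ, Real.sin (3 * Real.pi / 2 + ψ) = -Real.cos ψ := fun ψ => by
    rw [Real.sin_add, cos_three_pi_div_two, sin_three_pi_div_two]; ring
  have hα1 := pi_le_backAngle k
  have hα2 := backAngle_le k
  have hstart := sub_mem_edge .lowerRight x (k := k) (by omega) hr0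
    (by rwa [fullLen, if_neg (by omega)])
  rw [← circlePt_backAngle] at hstart
  refine ⟨backAngle k, 3 * Real.pi / 2 + φ, by linarith, ?_, hstart.1, ?_, ?_⟩
  · rw [abs_le]; constructor <;> linarith
  · unfold edge
    rw [if_neg (by omega), if_neg (by omega), if_neg (by omega), if_neg (by omega)]
    refine ⟨?_, ?_⟩
    · rw [circlePt_re, hcos, hsinφ]; ring
    · rw [circlePt_im, hsin]; linarith
  · rintro θ ⟨h1, h2⟩
    rw [min_eq_left (by linarith)] at h1
    rw [max_eq_right (by linarith)] at h2
    obtain ⟨ψ, rfl⟩ : ∃ ψ, θ = 3 * Real.pi / 2 + ψ := ⟨θ - 3 * Real.pi / 2, by ring⟩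
    have hψ1 : ψ < φ := by linarith
    have hψ2 : -(Real.pi / 2) < ψ := by linarith
    have hcosψ : 0 < Real.cos ψ := Real.cos_pos_of_mem_Ioo ⟨hψ2, by linarith⟩
    have hsinψ : Real.sin ψ < Real.sin φ :=
      Real.sin_lt_sin_of_lt_of_le_pi_div_two hψ2.le hφ1.le hψ1
    have hlt : (circlePt (vertex x.1 k) r (3 * Real.pi / 2 + ψ)).re < x.2 := by
      rw [circlePt_re, hcos]; nlinarith
    -- For a vertical edge the arc starts straight below `P_k` and stays to the lower right of
    -- `P_k`. For a horizontal edge it starts at the leftmost point of the circle, and that point is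
    -- the witness.
    by_cases hev : Even k
    · have hψ0 : 0 < ψ := by
        rw [backAngle, if_pos hev] at h1; linarith
      have := Real.sin_pos_of_pos_of_lt_pi hψ0 (by linarith)
      refine mem_lowerRight hl (vertex_mem_zigzag x.1 (k := k) (by omega)) ?_ ?_ hlt
      · rw [circlePt_re, hcos]; nlinarith
      · rw [circlePt_im, hsin]; nlinarith
    · have h3 : Real.sin (-(Real.pi / 2)) < Real.sin ψ :=
        Real.sin_lt_sin_of_lt_of_le_pi_div_two le_rfl (by linarith) hψ2
      rw [Real.sin_neg, Real.sin_pi_div_two] at h3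
      refine mem_lowerRight hl hstart.2 ?_ ?_ hlt
      · rw [circlePt_re, circlePt_re, hcos, backAngle, if_neg hev, Real.cos_pi]; nlinarith
      · rw [circlePt_im, circlePt_im, hsin, backAngle, if_neg hev, Real.sin_pi]; nlinarith

/-- In the lower right orthodisk, the two infinite edges of the zigzag are joined by quarters of
circles. -/
lemma hasArc_infinite_edges {x : (Fin g → ℝ) × ℝ} (hl : ∀ i, 0 ≤ x.1 i) {r : ℝ} (hr0 : 0 < r)
    (hr : 2 * cornerSize x.1 < r) (hrb : r < x.2) :
    HasArc (orthodisk .lowerRight x) (edge .lowerRight x 0) (edge .lowerRight x (2 * g + 1))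
      0 r := by
  have hpi := Real.pi_pos
  have ha : 0 ≤ cornerSize x.1 := Finset.sum_nonneg fun i _ => hl i
  refine ⟨3 * Real.pi / 2, 2 * Real.pi, by linarith, ?_, ?_, ?_, ?_⟩
  · rw [abs_le]; constructor <;> linarith
  · unfold edge
    rw [if_pos rfl]
    refine ⟨?_, ?_⟩
    · rw [circlePt_re, cos_three_pi_div_two]; simp
    · rw [circlePt_im, sin_three_pi_div_two, Complex.zero_im]; linarith
  · unfold edge
    rw [if_neg (by omega), if_neg (by omega), if_pos rfl]
    refine ⟨?_, ?_⟩
    · rw [circlePt_im, Real.sin_two_pi]; simp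
    · rw [circlePt_re, Real.cos_two_pi, Complex.zero_re]; linarith
  · rintro θ ⟨h1, h2⟩
    rw [min_eq_left (by linarith)] at h1
    rw [max_eq_right (by linarith)] at h2
    have hc : 0 < Real.cos θ := by
      rw [← Real.cos_sub_two_pi]
      exact Real.cos_pos_of_mem_Ioo ⟨by linarith, by linarith⟩
    have hs : Real.sin θ < 0 := by
      rw [← Real.sin_sub_two_pi]
      exact Real.sin_neg_of_neg_of_neg_pi_lt (by linarith) (by linarith)
    have h3 := Real.sin_sq_add_cos_sq θ
    have h4 := Real.cos_le_one θ
    have hlt : (circlePt 0 r θ).re < x.2 := by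
      rw [circlePt_re, Complex.zero_re]; nlinarith
    -- Not both coordinates can be small on the unit circle. Since `r > 2a`, the arc point is to the
    -- right of `(a, 0)` or below `(0, -a)`, and in either case on the lower right of that point.
    have h5 : 1 / 2 < Real.cos θ ∨ Real.sin θ < -(1 / 2) := by
      by_contra! h
      nlinarith
    rcases h5 with h5 | h5
    · refine mem_lowerRight hl (w := ⟨cornerSize x.1, 0⟩) (Or.inr ⟨rfl, le_rfl⟩) ?_ ?_ hlt
      · rw [circlePt_re, Complex.zero_re]; nlinarith
      · rw [circlePt_im, Complex.zero_im]; nlinarith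
    · refine mem_lowerRight hl (w := ⟨0, -cornerSize x.1⟩) (Or.inl (Or.inl ⟨rfl, le_rfl⟩)) ?_ ?_ hlt
      · rw [circlePt_re, Complex.zero_re]; nlinarith
      · rw [circlePt_im, Complex.zero_im]
        show 0 + r * Real.sin θ < -cornerSize x.1
        nlinarith

/-! ### Degeneration at a boundary point -/

lemma continuous_edgeLen (j : ℕ) : Continuous fun l : Fin g → ℝ => edgeLen l j := by
  unfold edgeLen
  split_ifs <;> fun_prop

lemma continuous_vertex (k : ℕ) : Continuous fun l : Fin g → ℝ => vertex l k := by
  induction k with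
  | zero =>
    have h : (fun l : Fin g → ℝ => vertex l 0) =
        fun l => -((cornerSize l : ℝ) : ℂ) * Complex.I := by
      funext l
      rw [vertex_zero]
      apply Complex.ext <;> simp
    rw [h]
    unfold cornerSize
    fun_prop
  | succ k ih =>
    simp only [vertex_succ]
    exact ih.add ((Complex.continuous_ofReal.comp (continuous_edgeLen k)).mul continuous_const)

lemma continuous_fullLen (k : ℕ) : Continuous fun l : Fin g → ℝ => fullLen l k := by
  unfold fullLen
  split_ifs
  · exact continuous_const
  · exact continuous_edgeLen _

/-- The edges of a degenerate zigzag that are next to a collapsed one. -/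
lemma exists_collapsed_run {l : Fin g → ℝ} (hl : ∀ i, 0 ≤ l i) {i : Fin g} (hi : l i = 0) :
    ∃ m n, m + 2 ≤ n ∧ n ≤ 2 * g + 1 ∧ 0 < fullLen l m ∧ 0 < fullLen l n ∧
      vertex l (n - 1) = vertex l m := by
  classical
  have hi0 : fullLen l (i + 1) = 0 := by
    have := i.2
    rw [fullLen, if_neg (by omega)]
    simp [edgeLen, hi]
  have hlast : 0 < fullLen l (2 * g + 1) := by simp [fullLen]
  have hfirst : 0 < fullLen l 0 := by simp [fullLen]
  have hnonneg : ∀ k, 0 ≤ fullLen l k := by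
    intro k
    unfold fullLen
    split_ifs
    · exact zero_le_one
    · exact edgeLen_nonneg hl _
  have hex : ∃ n, (i : ℕ) + 1 < n ∧ 0 < fullLen l n :=
    ⟨2 * g + 1, by have := i.2; omega, hlast⟩
  -- `n` and `m` are the nearest edges of positive length after and before the collapsed edge `i +
  -- 1`. They exist because the infinite edges `0` and `2g + 1` count as having length `1`; a
  -- collapsed edge lies between them, so they are not adjacent.
  set n := Nat.find hex with hn
  obtain ⟨hn1, hn2⟩ : (i : ℕ) + 1 < n ∧ 0 < fullLen l n := Nat.find_spec hex
  have hn3 : n ≤ 2 * g + 1 := Nat.find_min' hex ⟨by have := i.2; omega, hlast⟩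
  set m := Nat.findGreatest (fun m => 0 < fullLen l m) (i + 1) with hm
  have hm1 : 0 < fullLen l m :=
    Nat.findGreatest_spec (P := fun m => 0 < fullLen l m) (Nat.zero_le (i + 1)) hfirst
  have hm2 : m ≤ i + 1 := Nat.findGreatest_le _
  have hm3 : m ≠ i + 1 := by
    intro h
    rw [h, hi0] at hm1
    exact lt_irrefl _ hm1
  have hzero : ∀ j, m < j → j < n → fullLen l j = 0 := by
    intro j h1 h2
    refine le_antisymm (not_lt.1 fun h => ?_) (hnonneg j)
    rcases le_or_gt j (i + 1) with h3 | h3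
    · exact Nat.findGreatest_is_greatest (P := fun m => 0 < fullLen l m) h1 h3 h
    · exact Nat.find_min hex h2 ⟨h3, h⟩
  refine ⟨m, n, by omega, hn3, hm1, hn2, ?_⟩
  have hind : ∀ j, m ≤ j → j ≤ n - 1 → vertex l j = vertex l m := by
    intro j hj
    induction j, hj using Nat.le_induction with
    | base => exact fun _ => rfl
    | succ j hj ih =>
      intro h
      have h1 := hzero (j + 1) (by omega) (by omega)
      rw [fullLen, if_neg (by omega), Nat.add_sub_cancel] at h1
      rw [vertex_succ, ih (by omega), h1]
      simp
  exact hind (n - 1) (by omega) le_rfl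

section Boundary

variable {q : (Fin g → ℝ) × EReal}

lemma tendsto_lengths : Tendsto (fun x : coordDomain g => x.1.1)
    (comap (toExtended g) (𝓝 q)) (𝓝 q.1) :=
  (continuous_fst.tendsto q).comp tendsto_comap

lemma tendsto_width_ereal : Tendsto (fun x : coordDomain g => ((x.1.2 : ℝ) : EReal))
    (comap (toExtended g) (𝓝 q)) (𝓝 q.2) :=
  (continuous_snd.tendsto q).comp tendsto_comap

lemma tendsto_width {b : ℝ} (hb : q.2 = b) : Tendsto (fun x : coordDomain g => x.1.2)
    (comap (toExtended g) (𝓝 q)) (𝓝 b) := by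
  have h := tendsto_width_ereal (q := q)
  rw [hb] at h
  exact EReal.tendsto_coe.1 h

/-- Nontriviality of the approach filter is what allows the weak inequalities and the normalization
to pass to the limit `q`. -/
lemma neBot_of_mem_closure (hq : q ∈ closure (Set.range (toExtended g))) :
    (comap (toExtended g) (𝓝 q)).NeBot := by
  rw [comap_neBot_iff]
  intro t ht
  obtain ⟨_, h1, a, rfl⟩ := mem_closure_iff_nhds.1 hq t ht
  exact ⟨a, h1⟩

lemma nonneg_of_mem_coordDomain (x : coordDomain g) (i : Fin g) : 0 ≤ x.1.1 i := (x.2.1 i).le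

lemma cornerSize_of_mem_coordDomain (x : coordDomain g) : cornerSize x.1.1 = 1 / 2 := by
  have := x.2.2.2
  unfold cornerSize
  linarith

/-- As the strip width becomes infinite, the infinite edges of the zigzag come together. -/
lemma tendsto_extCycle_of_top (hb : q.2 = ⊤) :
    Tendsto (fun x : coordDomain g => extCycle .lowerRight 0 (2 * g + 1) x.1)
      (comap (toExtended g) (𝓝 q)) (𝓝 0) := by
  -- The inner radius `1` works because the normalization gives `2a = 1`.
  refine tendsto_extremalLength_zero fun M _ => ⟨1, one_pos, ?_⟩
  have h := tendsto_width_ereal (q := q)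
  rw [hb, EReal.tendsto_nhds_top_iff_real] at h
  filter_upwards [h M] with x hx
  have hx' : M < x.1.2 := EReal.coe_lt_coe_iff.1 hx
  refine ⟨0, fun r hr => hasArc_infinite_edges (nonneg_of_mem_coordDomain x)
    (one_pos.trans hr.1) ?_ ?_⟩
  · rw [cornerSize_of_mem_coordDomain]
    linarith [hr.1]
  · linarith [hr.2]

/-- As the vertex `V` approaches the line of the edge `P_{k-1} P_k`, this edge and the edge
`V E_2` come together in the lower right orthodisk. -/
lemma tendsto_extCycle_of_width_eq {k : ℕ} (hk : 1 ≤ k) (hkg : k ≤ g)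
    (hpos : 0 < edgeLen q.1 (k - 1)) (hb : q.2 = ((vertex q.1 k).re : ℝ)) :
    Tendsto (fun x : coordDomain g => extCycle .lowerRight k (2 * g + 3) x.1)
      (comap (toExtended g) (𝓝 q)) (𝓝 0) := by
  refine tendsto_extremalLength_zero fun M hM => ?_
  set L := edgeLen q.1 (k - 1) with hL
  have hM0 : 0 < M := one_pos.trans hM
  -- The outer radius is `L / 2`, which stays below the length of the edge near `q`, while `2 (b -
  -- Re P_k)` tends to `0` and drops below the fixed inner radius.
  refine ⟨L / (2 * M), by positivity, ?_⟩
  have h1 : Tendsto (fun x : coordDomain g => edgeLen x.1.1 (k - 1))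
      (comap (toExtended g) (𝓝 q)) (𝓝 L) :=
    ((continuous_edgeLen (k - 1)).tendsto q.1).comp tendsto_lengths
  have h2 : Tendsto (fun x : coordDomain g => (vertex x.1.1 k).re)
      (comap (toExtended g) (𝓝 q)) (𝓝 (vertex q.1 k).re) :=
    ((Complex.continuous_re.comp (continuous_vertex k)).tendsto q.1).comp tendsto_lengths
  have h3 := ((tendsto_width hb).sub h2).const_mul 2
  rw [sub_self, mul_zero] at h3
  filter_upwards [h1.eventually_const_lt (half_lt_self hpos),
    h3.eventually_lt_const (show 0 < L / (2 * M) by positivity)] with x hx1 hx2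
  refine ⟨vertex x.1.1 k, fun r hr => hasArc_lowerRight (nonneg_of_mem_coordDomain x) x.2.2.1 hk
    hkg (hx2.trans hr.1) (hr.2.trans ?_)⟩
  have : M * (L / (2 * M)) = L / 2 := by field_simp
  rwa [this]

/-- When a run of edges collapses, the edges before and after it come together in the upper left
orthodisk. -/
lemma tendsto_extCycle_of_collapse {m n : ℕ} (hmn : m < n) (hn : n ≤ 2 * g + 1)
    (hm0 : 0 < fullLen q.1 m) (hn0 : 0 < fullLen q.1 n)
    (hv : vertex q.1 (n - 1) = vertex q.1 m) {b : ℝ} (hb : q.2 = b) (hb0 : 0 < b) :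
    Tendsto (fun x : coordDomain g => extCycle .upperLeft m n x.1)
      (comap (toExtended g) (𝓝 q)) (𝓝 0) := by
  refine tendsto_extremalLength_zero fun M hM => ?_
  -- The outer radius `R` is limited only by data that stay positive at `q`; the inner radius `R /
  -- M` need only exceed the size of the collapsing run.
  obtain ⟨R, hR0, hRm, hRn, hRb⟩ : ∃ R, 0 < R ∧ R < fullLen q.1 m ∧ R < fullLen q.1 n ∧ R < b := by
    obtain ⟨R, h1, h2⟩ := exists_between (lt_min hm0 (lt_min hn0 hb0))
    exact ⟨R, h1, (lt_min_iff.1 h2).1, (lt_min_iff.1 (lt_min_iff.1 h2).2)⟩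
  have hM0 : 0 < M := one_pos.trans hM
  have hε : 0 < R / M := by positivity
  refine ⟨R / M, hε, ?_⟩
  rw [mul_div_cancel₀ _ hM0.ne']
  have hlen : ∀ k, Tendsto (fun x : coordDomain g => fullLen x.1.1 k)
      (comap (toExtended g) (𝓝 q)) (𝓝 (fullLen q.1 k)) := fun k =>
    ((continuous_fullLen k).tendsto q.1).comp tendsto_lengths
  have hvert : ∀ k, Tendsto (fun x : coordDomain g => vertex x.1.1 k)
      (comap (toExtended g) (𝓝 q)) (𝓝 (vertex q.1 k)) := fun k =>
    ((continuous_vertex k).tendsto q.1).comp tendsto_lengths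
  have hre : ∀ k, Tendsto (fun x : coordDomain g => (vertex x.1.1 k).re)
      (comap (toExtended g) (𝓝 q)) (𝓝 (vertex q.1 k).re) := fun k =>
    (Complex.continuous_re.tendsto _).comp (hvert k)
  have him : ∀ k, Tendsto (fun x : coordDomain g => (vertex x.1.1 k).im)
      (comap (toExtended g) (𝓝 q)) (𝓝 (vertex q.1 k).im) := fun k =>
    (Complex.continuous_im.tendsto _).comp (hvert k)
  have hdiff := ((hre (n - 1)).sub (hre m)).add ((him (n - 1)).sub (him m))
  rw [hv, sub_self, sub_self, add_zero] at hdiff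
  filter_upwards [(hlen m).eventually_const_lt hRm, (hlen n).eventually_const_lt hRn,
    (tendsto_width hb).eventually_const_lt hRb, hdiff.eventually_lt_const hε]
    with x hx1 hx2 hx3 hx4
  exact ⟨vertex x.1.1 m, fun r hr => hasArc_upperLeft (nonneg_of_mem_coordDomain x) hmn hn
    (hx4.trans hr.1) (hε.trans hr.1) (hr.2.trans hx1) (hr.2.trans hx2) (hr.2.trans hx3)⟩

/-- At every boundary point of `Δ_g` the extremal length of some cycle tends to zero. -/
theorem exists_tendsto_extCycle_zero (hg : 1 ≤ g) (hq : q ∈ coordBoundary g) :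
    ∃ (s : Side) (i j : ℕ), IsCycle g i j ∧
      Tendsto (fun x : coordDomain g => extCycle s i j x.1)
        (comap (toExtended g) (𝓝 q)) (𝓝 0) := by
  obtain ⟨hcl, hnot⟩ := hq
  have hne := neBot_of_mem_closure hcl
  have hl : ∀ i, 0 ≤ q.1 i := fun i =>
    ge_of_tendsto' (((continuous_apply i).tendsto q.1).comp tendsto_lengths)
      fun x => nonneg_of_mem_coordDomain x i
  have hsum : 2 * ∑ i, q.1 i = 1 := by
    have hc : Continuous fun l : Fin g → ℝ => 2 * ∑ i, l i := by fun_prop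
    refine tendsto_nhds_unique ((hc.tendsto q.1).comp tendsto_lengths) ?_
    refine tendsto_const_nhds.congr fun x => ?_
    exact x.2.2.2.symm
  have hdiag : ((diagCoord q.1 : ℝ) : EReal) ≤ q.2 := by
    have hc : Continuous fun l : Fin g → ℝ => ((diagCoord l : ℝ) : EReal) :=
      continuous_coe_real_ereal.comp (Complex.continuous_re.comp (continuous_vertex g))
    refine le_of_tendsto_of_tendsto' ((hc.tendsto q.1).comp tendsto_lengths) tendsto_width_ereal
      fun x => ?_
    exact EReal.coe_le_coe_iff.2 x.2.2.1.le
  by_cases htop : q.2 = ⊤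
  · exact ⟨_, _, _, ⟨by omega, by omega, by omega⟩, tendsto_extCycle_of_top htop⟩
  have hbot : q.2 ≠ ⊥ := fun h => by
    rw [h] at hdiag
    exact EReal.coe_ne_bot _ (le_bot_iff.1 hdiag)
  obtain ⟨b, hb⟩ : ∃ b : ℝ, q.2 = b := ⟨q.2.toReal, (EReal.coe_toReal htop hbot).symm⟩
  rw [hb, EReal.coe_le_coe_iff] at hdiag
  have hdiag0 : 0 ≤ diagCoord q.1 := by
    simpa [vertex_zero, diagCoord] using monotone_vertex_re hl (Nat.zero_le g)
  have hS : ∀ k, 1 ≤ k → k ≤ g → 0 < edgeLen q.1 (k - 1) → b = (vertex q.1 k).re →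
      ∃ (s : Side) (i j : ℕ), IsCycle g i j ∧
      Tendsto (fun x : coordDomain g => extCycle s i j x.1)
        (comap (toExtended g) (𝓝 q)) (𝓝 0) := fun k h1 h2 h3 h4 =>
    ⟨_, _, _, ⟨by omega, by omega, by omega⟩,
      tendsto_extCycle_of_width_eq h1 h2 h3 (by rw [hb, h4])⟩
  by_cases hpos : ∀ i, 0 < q.1 i
  -- With all lengths positive and `b` finite, `c < b` is the only condition that can fail at `q`.
  · have hbc : b = diagCoord q.1 := by
      refine le_antisymm (not_lt.1 fun h => hnot ?_) hdiag
      exact ⟨⟨(q.1, b), hpos, h, hsum⟩, Prod.ext rfl hb.symm⟩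
    refine hS g hg le_rfl ?_ hbc
    rw [edgeLen, dif_pos (by omega)]
    exact hpos _
  push Not at hpos
  obtain ⟨i, hi⟩ := hpos
  -- The case `b = 0` is separate because circles of a fixed radius no longer fit into the upper
  -- left orthodisk. Then `0 ≤ Re P_k ≤ c ≤ b = 0` for every `k ≤ g`, so any edge with positive
  -- limit length will do, and the normalization supplies one.
  rcases (hdiag0.trans hdiag).eq_or_lt with hb0 | hb0
  · obtain ⟨k, hk⟩ : ∃ k, 0 < q.1 k := by
      by_contra! h
      have := Finset.sum_nonpos fun i (_ : i ∈ Finset.univ) => h i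
      linarith
    refine hS (k + 1) (by omega) (by omega) (by simpa [edgeLen] using hk) ?_
    have h1 : (vertex q.1 (k + 1)).re ≤ diagCoord q.1 :=
      monotone_vertex_re hl (show (k : ℕ) + 1 ≤ g by omega)
    have h2 : 0 ≤ (vertex q.1 (k + 1)).re := by
      simpa [vertex_zero] using monotone_vertex_re hl (Nat.zero_le (k + 1))
    linarith
  · obtain ⟨m, n, h1, h2, h3, h4, h5⟩ := exists_collapsed_run hl (le_antisymm hi (hl i))
    exact ⟨_, _, _, ⟨h1, by omega, by omega⟩,
      tendsto_extCycle_of_collapse (by omega) h2 h3 h4 h5 hb hb0⟩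

end Boundary

/-! ### Compactness: from sequences to boundary points -/

lemma isInducing_toExtended (g : ℕ) : IsInducing (toExtended g) :=
  (IsInducing.id.prodMap EReal.isEmbedding_coe.isInducing).comp IsInducing.subtypeVal

/-- A sequence that leaves every compact subset of `Δ_g` has a subsequence that converges to a
boundary point. -/
lemma exists_subseq_tendsto_boundary {p : ℕ → coordDomain g}
    (hp : Tendsto p atTop (cocompact (coordDomain g))) :
    ∃ φ : ℕ → ℕ, StrictMono φ ∧ ∃ q ∈ coordBoundary g,
      Tendsto (fun n => toExtended g (p (φ n))) atTop (𝓝 q) := by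
  have hK : IsCompact ((Set.univ.pi fun _ : Fin g => Set.Icc (0 : ℝ) 1) ×ˢ
      (Set.univ : Set EReal)) :=
    (isCompact_univ_pi fun _ => isCompact_Icc).prod isCompact_univ
  have hmem : ∀ n, toExtended g (p n) ∈ (Set.univ.pi fun _ : Fin g => Set.Icc (0 : ℝ) 1) ×ˢ
      (Set.univ : Set EReal) := by
    refine fun n => ⟨fun i _ => ⟨nonneg_of_mem_coordDomain _ i, ?_⟩, trivial⟩
    have h1 := Finset.single_le_sum (fun j _ => nonneg_of_mem_coordDomain (p n) j)
      (Finset.mem_univ i)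
    have h2 := (p n).2.2.2
    show (p n).1.1 i ≤ 1
    linarith
  obtain ⟨q, -, φ, hφ, hlim⟩ := hK.tendsto_subseq hmem
  refine ⟨φ, hφ, q, ⟨mem_closure_of_tendsto hlim (Eventually.of_forall fun n => ⟨_, rfl⟩), ?_⟩, hlim⟩
  rintro ⟨x, rfl⟩
  have hx : Tendsto (p ∘ φ) atTop (𝓝 x) := (isInducing_toExtended g).tendsto_nhds_iff.2 hlim
  -- If the limit were in `Δ_g`, the subsequence together with its limit would be a compact set that
  -- the sequence never leaves.
  have hev := (hp.comp hφ.tendsto_atTop) hx.isCompact_insert_range.compl_mem_cocompact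
  obtain ⟨n, hn⟩ := (mem_map.1 hev |> Filter.nonempty_of_mem)
  exact hn (Set.mem_insert_of_mem _ ⟨n, rfl⟩)

end ScherkOrthodisk

theorem mainTheorem10 (g : ℕ) (hg : 1 ≤ g) :
    -- sequences that leave every compact subset of the space of geometric coordinates
    (∀ p : ℕ → ScherkOrthodisk.coordDomain g,
      Filter.Tendsto p Filter.atTop (Filter.cocompact (ScherkOrthodisk.coordDomain g)) →
      ∃ φ : ℕ → ℕ, StrictMono φ ∧
        ∃ (s : ScherkOrthodisk.Side) (i j : ℕ), ScherkOrthodisk.IsCycle g i j ∧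
          (Filter.Tendsto (fun n => ScherkOrthodisk.extCycle s i j (p (φ n)).1)
              Filter.atTop (nhds 0) ∨
            Filter.Tendsto (fun n => ScherkOrthodisk.extCycle s i j (p (φ n)).1)
              Filter.atTop (nhds ⊤))) ∧
    -- convergence to a point of the boundary
    (∀ q ∈ ScherkOrthodisk.coordBoundary g,
      ∃ (s : ScherkOrthodisk.Side) (i j : ℕ), ScherkOrthodisk.IsCycle g i j ∧
        (Filter.Tendsto
            (fun x : ScherkOrthodisk.coordDomain g => ScherkOrthodisk.extCycle s i j x.1)
            (Filter.comap (ScherkOrthodisk.toExtended g) (nhds q)) (nhds 0) ∨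
          Filter.Tendsto
            (fun x : ScherkOrthodisk.coordDomain g => ScherkOrthodisk.extCycle s i j x.1)
            (Filter.comap (ScherkOrthodisk.toExtended g) (nhds q)) (nhds ⊤))) := by
  refine ⟨fun p hp => ?_, fun q hq => ?_⟩
  · obtain ⟨φ, hφ, q, hq, hlim⟩ := ScherkOrthodisk.exists_subseq_tendsto_boundary hp
    obtain ⟨s, i, j, hc, h⟩ := ScherkOrthodisk.exists_tendsto_extCycle_zero hg hq
    exact ⟨φ, hφ, s, i, j, hc, Or.inl (h.comp (tendsto_comap_iff.2 hlim))⟩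
  · obtain ⟨s, i, j, hc, h⟩ := ScherkOrthodisk.exists_tendsto_extCycle_zero hg hq
    exact ⟨s, i, j, hc, Or.inl h⟩
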